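/- Let $X_1,X_2,\dots$ be independent, identically distributed, positive random variables having a density with respect to Lebesgue measure, and let $d>0$. Put \[ h^{(1)}(x_1,x_2;d)=\frac{|x_1-x_2|}{x_1+x_2}\,\mathbf 1(x_1+x_2>d),\qquad h^{(2)}(x_1,x_2;d)=\mathbf 1(x_1+x_2>d), \] \[ U_n^{(l)}(d)=\frac{2}{n(n-1)}\sum_{1\le i<j\le n}h^{(l)}(X_i,X_j;d)\quad(l=1,2),\qquad \hat g_n(d)=\frac{U_n^{(1)}(d)}{U_n^{(2)}(d)}, \] where $\hat g_n(d)$ is set to $0$ when $U_n^{(2)}(d)=0$. Let $\nu_d=P(X_1+X_2>d)$ and \[ g(d)=E\Big[\tfrac{|X_1-X_2|}{X_1+X_2}\,\Big|\,X_1+X_2>d\Big]. \] For $l=1,2$ let $\theta_d^{(l)}=E[h^{(l)}(X_1,X_2;d)]$, $\psi_1^{(l)}(x;d)=E[h^{(l)}(x,X_2;d)-\theta_d^{(l)}]$, $\eta_1^{(l)}(d)=E[(\psi_1^{(l)}(X_1;d))^2]$, and let $\eta_1^{(1,2)}(d)=E[\psi_1^{(1)}(X_1;d)\,\psi_1^{(2)}(X_1;d)]$.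 If $\nu_d>0$ and $\eta_1^{(l)}(d)>0$ for $l=1,2$, then, as $n\to\infty$, \[ \sqrt{n\nu_d}\,\big(\hat g_n(d)-g(d)\big)\ \xrightarrow{\ \mathcal D\ }\ N(0,\sigma_d^2),\qquad \sigma_d^2=\frac{4}{\nu_d}\Big(\eta_1^{(1)}(d)-2g(d)\,\eta_1^{(1,2)}(d)+g(d)^2\,\eta_1^{(2)}(d)\Big), \] where $\sigma_d^2\ge 0$ and $N(0,0)$ denotes the point mass at $0$. -/

import Mathlib

open MeasureTheory ProbabilityTheory Filter

namespace GammaTail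

noncomputable section

/-- The kernel `h⁽¹⁾(x, y; d) = |x - y| / (x + y) · 1(x + y > d)`. -/
def h1 (d x y : ℝ) : ℝ := if d < x + y then |x - y| / (x + y) else 0

/-- The kernel `h⁽²⁾(x, y; d) = 1(x + y > d)`. -/
def h2 (d x y : ℝ) : ℝ := if d < x + y then 1 else 0

/-- The U-statistic of degree 2 with kernel `h`, computed from the first `n` observations
(the sample is indexed from `0`, so the sum runs over all pairs `i < j < n`). -/
def uStat {Ω : Type*} (h : ℝ → ℝ → ℝ) (X : ℕ → Ω → ℝ) (n : ℕ) (ω : Ω) : ℝ :=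
  2 / ((n : ℝ) * ((n : ℝ) - 1)) *
    ∑ j ∈ Finset.range n, ∑ i ∈ Finset.range j, h (X i ω) (X j ω)

/-- The ratio estimator `ĝ_n(d) = U_n⁽¹⁾(d) / U_n⁽²⁾(d)`. -/
def gHat {Ω : Type*} (X : ℕ → Ω → ℝ) (d : ℝ) (n : ℕ) (ω : Ω) : ℝ :=
  uStat (h1 d) X n ω / uStat (h2 d) X n ω

variable {Ω : Type*} [MeasurableSpace Ω]

/-- `ν_d = P(X₁ + X₂ > d)`. -/
def nu (P : Measure Ω) (X : ℕ → Ω → ℝ) (d : ℝ) : ℝ :=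
  P.real {ω | d < X 0 ω + X 1 ω}

/-- `g(d) = E[|X₁ - X₂| / (X₁ + X₂) | X₁ + X₂ > d]`, the expectation under the conditional
probability given the event `X₁ + X₂ > d`. -/
def g (P : Measure Ω) (X : ℕ → Ω → ℝ) (d : ℝ) : ℝ :=
  ∫ ω, |X 0 ω - X 1 ω| / (X 0 ω + X 1 ω) ∂(P[|{ω | d < X 0 ω + X 1 ω}])

/-- `θ = E[h(X₁, X₂)]`. -/
def theta (P : Measure Ω) (X : ℕ → Ω → ℝ) (h : ℝ → ℝ → ℝ) : ℝ :=
  ∫ ω, h (X 0 ω) (X 1 ω) ∂P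

/-- The projection `ψ₁(x) = E[h(x, X₂) - θ]` of the centred kernel. -/
def psi (P : Measure Ω) (X : ℕ → Ω → ℝ) (h : ℝ → ℝ → ℝ) (x : ℝ) : ℝ :=
  ∫ ω, (h x (X 1 ω) - theta P X h) ∂P

/-- `E[ψ₁(X₁) ψ₁'(X₁)]` for the projections `ψ₁`, `ψ₁'` of the kernels `h`, `h'`. -/
def eta (P : Measure Ω) (X : ℕ → Ω → ℝ) (h h' : ℝ → ℝ → ℝ) : ℝ :=
  ∫ ω, psi P X h (X 0 ω) * psi P X h' (X 0 ω) ∂P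

/-- The asymptotic variance
`σ_d² = (4 / ν_d) (η₁⁽¹⁾(d) - 2 g(d) η₁⁽¹'²⁾(d) + g(d)² η₁⁽²⁾(d))`. -/
def sigmaSq (P : Measure Ω) (X : ℕ → Ω → ℝ) (d : ℝ) : ℝ :=
  4 / nu P X d * (eta P X (h1 d) (h1 d) - 2 * g P X d * eta P X (h1 d) (h2 d)
    + g P X d ^ 2 * eta P X (h2 d) (h2 d))

end

end GammaTail

/-! Write `g = θ⁽¹⁾ / θ⁽²⁾`. The ratio error is `ĝ_n - g = U_n(κ) / U_n⁽²⁾`, where `U_n(κ)` is the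
U-statistic of the *centred* kernel `κ = h⁽¹⁾ - g h⁽²⁾`, whose projection has second moment
`η⁽¹⁾ - 2 g η⁽¹,²⁾ + g² η⁽²⁾`. Hoeffding's decomposition splits a U-statistic into an average of
i.i.d. variables, governed by the central limit theorem, and the U-statistic of a degenerate kernel,
whose terms are pairwise uncorrelated, so that it has variance `O(n⁻²)` and is negligible at scale
`√n`. Slutsky's theorem then handles the denominator `U_n⁽²⁾ → ν_d`. -/

namespace GammaTail

open scoped Topology

/-! ### Convergence in probability and in distribution -/

section Convergence

variable {ι Ω Ω' : Type*} [MeasurableSpace Ω] [MeasurableSpace Ω'] {P : Measure Ω}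
  {P' : Measure Ω'} {l : Filter ι}

theorem tendstoInMeasure_zero_of_tendsto_measure_support {E : Type*} [SeminormedAddCommGroup E]
    {Y : ι → Ω → E} (hY : Tendsto (fun i => P (Function.support (Y i))) l (𝓝 0)) :
    TendstoInMeasure P Y l 0 := by
  rw [tendstoInMeasure_iff_norm]
  refine fun ε hε => tendsto_of_tendsto_of_tendsto_of_le_of_le tendsto_const_nhds hY
    (fun _ => zero_le) fun i => measure_mono fun ω hω => ?_
  intro h0
  simp only [Set.mem_ofPred_eq, h0, Pi.zero_apply, sub_zero, norm_zero] at hω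
  exact hε.not_ge hω

theorem tendstoInMeasure_comp_of_continuousAt {E F : Type*} [PseudoMetricSpace E]
    [PseudoMetricSpace F] {Y : ι → Ω → E} {c : E} {f : E → F}
    (hY : TendstoInMeasure P Y l fun _ => c) (hf : ContinuousAt f c) :
    TendstoInMeasure P (fun i ω => f (Y i ω)) l fun _ => f c := by
  rw [tendstoInMeasure_iff_dist] at hY ⊢
  intro ε hε
  obtain ⟨δ, hδ, hfδ⟩ := Metric.continuousAt_iff.1 hf ε hε
  refine tendsto_of_tendsto_of_tendsto_of_le_of_le tendsto_const_nhds (hY δ hδ)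
    (fun _ => zero_le) fun i => measure_mono fun ω hω => ?_
  exact le_of_not_gt fun h => hω.not_gt (hfδ h)

theorem tendstoInMeasure_sub_integral_of_tendsto_variance [IsFiniteMeasure P] {Y : ι → Ω → ℝ}
    (hY : ∀ i, MemLp (Y i) 2 P) (hvar : Tendsto (fun i => Var[Y i; P]) l (𝓝 0)) :
    TendstoInMeasure P (fun i ω => Y i ω - ∫ ω', Y i ω' ∂P) l 0 := by
  rw [tendstoInMeasure_iff_norm]
  intro ε hε
  have hbound : Tendsto (fun i => ENNReal.ofReal (Var[Y i; P] / ε ^ 2)) l (𝓝 0) := by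
    simpa using ENNReal.tendsto_ofReal (hvar.div_const (ε ^ 2))
  refine tendsto_of_tendsto_of_tendsto_of_le_of_le tendsto_const_nhds hbound
    (fun _ => zero_le) fun i => ?_
  simpa using meas_ge_le_variance_div_sq (hY i) hε

theorem tendsto_measure_eq_zero_of_tendstoInMeasure_const {E : Type*} [NormedAddCommGroup E]
    {Y : ι → Ω → E} {c : E} (hc : c ≠ 0) (hY : TendstoInMeasure P Y l fun _ => c) :
    Tendsto (fun i => P {ω | Y i ω = 0}) l (𝓝 0) := by
  refine tendsto_of_tendsto_of_tendsto_of_le_of_le tendsto_const_nhds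
    (tendstoInMeasure_iff_norm.1 hY ‖c‖ (norm_pos_iff.2 hc)) (fun _ => zero_le)
    fun i => measure_mono fun ω (hω : Y i ω = 0) => ?_
  simp [hω]

theorem hasLaw_gaussianReal_toNNReal_const_mul {Z : Ω' → ℝ} {v : ℝ}
    (hZ : HasLaw Z (gaussianReal 0 v.toNNReal) P') (c : ℝ) :
    HasLaw (fun ω => c * Z ω) (gaussianReal 0 (c ^ 2 * v).toNNReal) P' := by
  have h := gaussianReal_const_mul hZ c
  rwa [mul_zero, ← Real.toNNReal_of_nonneg, ← Real.toNNReal_mul (sq_nonneg c)] at h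

variable [IsProbabilityMeasure P] [IsProbabilityMeasure P']

theorem tendstoInMeasure_of_tendstoInDistribution_const {E : Type*} [PseudoMetricSpace E]
    [MeasurableSpace E] [BorelSpace E] {Y : ι → Ω → E} {c : E}
    (hY : TendstoInDistribution Y l (fun _ => c) (fun _ => P) P') :
    TendstoInMeasure P Y l fun _ => c := by
  rw [tendstoInMeasure_iff_dist]
  intro ε hε
  have hS : IsClosed {x : E | ε ≤ dist x c} :=
    isClosed_le continuous_const (continuous_id.dist continuous_const)
  have hlaw : P'.map (fun _ => c) = Measure.dirac c := by simp [Measure.map_const]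
  have hnull : Measure.dirac c {x : E | ε ≤ dist x c} = 0 := by
    rw [Measure.dirac_apply' _ hS.measurableSet]
    simp [hε]
  have hlim := ProbabilityMeasure.tendsto_measure_of_null_frontier_of_tendsto' hY.tendsto
    (E := {x : E | ε ≤ dist x c})
    (by simpa only [ProbabilityMeasure.coe_mk, hlaw] using
      measure_mono_null hS.frontier_subset hnull)
  simp only [ProbabilityMeasure.coe_mk, hlaw, hnull] at hlim
  refine hlim.congr fun i => ?_
  rw [Measure.map_apply_of_aemeasurable (hY.forall_aemeasurable i) hS.measurableSet]
  rfl

theorem tendstoInMeasure_const_of_tendstoInDistribution_mul_sub [l.IsCountablyGenerated]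
    {a : ι → ℝ} {Y : ι → Ω → ℝ} {Z : Ω' → ℝ} {c : ℝ} (ha : Tendsto a l atTop)
    (hY : TendstoInDistribution (fun i ω => a i * (Y i ω - c)) l Z (fun _ => P) P') :
    TendstoInMeasure P Y l fun _ => c := by
  have ha' : TendstoInMeasure P (fun i (_ : Ω) => (a i)⁻¹) l fun _ => 0 := by
    refine tendstoInMeasure_iff_norm.2 fun ε hε => tendsto_nhds_of_eventually_eq ?_
    filter_upwards [(tendsto_inv_atTop_zero.comp ha).norm.eventually_lt_const
      (by simpa using hε)] with i (hi : ‖(a i)⁻¹‖ < ε)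
    simp only [sub_zero, hi.not_ge, Set.ofPred_false, measure_empty]
  have hprod := hY.continuous_comp_prodMk_of_tendstoInMeasure_const
    (g := fun p : ℝ × ℝ => p.2 * p.1 + c) (by fun_prop) ha' fun _ => aemeasurable_const
  simp only [zero_mul, zero_add] at hprod
  refine (tendstoInMeasure_of_tendstoInDistribution_const hprod).congr' ?_ .rfl
  filter_upwards [ha.eventually_ne_atTop 0] with i hi
  exact ae_of_all _ fun ω => by simp [hi]

theorem tendstoInDistribution_div [l.IsCountablyGenerated] {A U : ι → Ω → ℝ} {Z : Ω' → ℝ} {u : ℝ}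
    (hu : u ≠ 0) (hA : TendstoInDistribution A l Z (fun _ => P) P')
    (hU : TendstoInMeasure P U l fun _ => u) (hUm : ∀ i, AEMeasurable (U i) P) :
    TendstoInDistribution (fun i ω => A i ω / U i ω) l (fun ω => Z ω / u) (fun _ => P) P' := by
  simp_rw [div_eq_mul_inv]
  exact hA.continuous_comp_prodMk_of_tendstoInMeasure_const (g := fun p : ℝ × ℝ => p.1 * p.2)
    (by fun_prop) (tendstoInMeasure_comp_of_continuousAt hU (continuousAt_inv₀ hu))
    fun i => (hUm i).inv

end Convergence

/-! ### Independent pairs and product measures -/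

section Decoupling

theorem identDistrib_comp_of_measurePreserving {Ω Ω' α : Type*} [MeasurableSpace Ω]
    [MeasurableSpace Ω'] [MeasurableSpace α] {P : Measure Ω} {Q : Measure Ω'} {W : Ω → α}
    {f : Ω' → Ω} (hW : AEMeasurable W P) (hf : MeasurePreserving f Q P) :
    IdentDistrib W (W ∘ f) P Q :=
  have hlaw := HasLaw.comp ⟨hW, rfl⟩ hf.hasLaw
  ⟨hW, hlaw.aemeasurable, hlaw.map_eq.symm⟩

variable {Ω α β : Type*} [MeasurableSpace Ω] [MeasurableSpace α] [MeasurableSpace β]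
  {P : Measure Ω} [IsProbabilityMeasure P] {W : Ω → α} {Y : Ω → β}

theorem identDistrib_prodMk_prod_of_indepFun (hWY : IndepFun W Y P) (hW : AEMeasurable W P)
    (hY : AEMeasurable Y P) :
    IdentDistrib (fun ω => (W ω, Y ω)) (fun z : Ω × Ω => (W z.1, Y z.2)) P (P.prod P) := by
  have hfst : IdentDistrib W (fun z : Ω × Ω => W z.1) P (P.prod P) :=
    identDistrib_comp_of_measurePreserving hW measurePreserving_fst
  have hsnd : IdentDistrib Y (fun z : Ω × Ω => Y z.2) P (P.prod P) :=
    identDistrib_comp_of_measurePreserving hY measurePreserving_snd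
  exact hfst.prodMk hsnd hWY (indepFun_prod₀ hW hY)

theorem integral_comp_of_indepFun (hWY : IndepFun W Y P) (hW : AEMeasurable W P)
    (hY : AEMeasurable Y P) {f : α × β → ℝ} (hf : Measurable f)
    (hint : Integrable (fun ω => f (W ω, Y ω)) P) :
    ∫ ω, f (W ω, Y ω) ∂P = ∫ ω, ∫ ω', f (W ω, Y ω') ∂P ∂P := by
  have h := (identDistrib_prodMk_prod_of_indepFun hWY hW hY).comp hf
  exact h.integral_eq.trans (integral_prod _ (h.integrable_snd hint))

theorem memLp_two_integral_prod {μ : Measure α} {ν : Measure β} [SFinite μ]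
    [IsProbabilityMeasure ν] {f : α × β → ℝ} (hf : MemLp f 2 (μ.prod ν)) :
    MemLp (fun x => ∫ y, f (x, y) ∂ν) 2 μ := by
  have hmeas := hf.aestronglyMeasurable.integral_prod_right'
  rw [memLp_two_iff_integrable_sq hmeas]
  refine hf.integrable_sq.integral_prod_left.mono' (hmeas.pow 2) ?_
  filter_upwards [hf.integrable_sq.prod_right_ae, hf.aestronglyMeasurable.prodMk_left]
    with x hsq hx
  have hvar := variance_eq_sub ((memLp_two_iff_integrable_sq hx).2 hsq)
  rw [Real.norm_of_nonneg (sq_nonneg _)]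
  have := hvar ▸ variance_nonneg (fun y => f (x, y)) ν
  simpa using this

theorem variance_fun_sum_of_covariance_eq_zero {ι : Type*} {s : Finset ι} {Y : ι → Ω → ℝ}
    (hY : ∀ i ∈ s, MemLp (Y i) 2 P)
    (hcov : ∀ i ∈ s, ∀ j ∈ s, i ≠ j → cov[Y i, Y j; P] = 0) :
    Var[fun ω => ∑ i ∈ s, Y i ω; P] = ∑ i ∈ s, Var[Y i; P] := by
  rw [variance_fun_sum' hY]
  refine Finset.sum_congr rfl fun i hi => ?_
  rw [Finset.sum_eq_single_of_mem i hi fun j hj hji => hcov i hi j hj hji.symm,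
    covariance_self (hY i hi).aemeasurable]

end Decoupling

/-! ### Algebra of U-statistics -/

section Algebra

theorem sum_range_sum_range_const {K : Type*} [Field K] [CharZero K] (c : K) (n : ℕ) :
    ∑ j ∈ Finset.range n, ∑ _i ∈ Finset.range j, c = (n : K) * ((n : K) - 1) / 2 * c := by
  induction n with
  | zero => simp
  | succ n ih =>
    rw [Finset.sum_range_succ, ih, Finset.sum_const, Finset.card_range, nsmul_eq_mul]
    push_cast
    ring

theorem sum_range_sum_range_add {R : Type*} [CommRing R] (a : ℕ → R) (n : ℕ) :
    ∑ j ∈ Finset.range n, ∑ i ∈ Finset.range j, (a i + a j)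
      = ((n : R) - 1) * ∑ i ∈ Finset.range n, a i := by
  induction n with
  | zero => simp
  | succ n ih =>
    rw [Finset.sum_range_succ, ih, Finset.sum_range_succ, Finset.sum_add_distrib,
      Finset.sum_const, Finset.card_range, nsmul_eq_mul]
    push_cast
    ring

variable {Ω : Type*}

theorem uStat_sub_mul (X : ℕ → Ω → ℝ) (k l : ℝ → ℝ → ℝ) (c : ℝ) (n : ℕ) (ω : Ω) :
    uStat (fun x y => k x y - c * l x y) X n ω = uStat k X n ω - c * uStat l X n ω := by
  unfold uStat
  simp only [Finset.sum_sub_distrib, ← Finset.mul_sum]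
  ring

variable [MeasurableSpace Ω]

/-- The degenerate part `k(x, y) - θ - ψ₁(x) - ψ₁(y)` of the kernel `k` in Hoeffding's
decomposition: integrating out either variable against the law of the sample gives `0`. -/
noncomputable def degeneratePart (P : Measure Ω) (X : ℕ → Ω → ℝ) (k : ℝ → ℝ → ℝ) (x y : ℝ) : ℝ :=
  k x y - theta P X k - psi P X k x - psi P X k y

theorem degeneratePart_symm {P : Measure Ω} {X : ℕ → Ω → ℝ} {k : ℝ → ℝ → ℝ}
    (hsymm : ∀ x y, k x y = k y x) (x y : ℝ) :
    degeneratePart P X k x y = degeneratePart P X k y x := by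
  unfold degeneratePart
  rw [hsymm x y]
  ring

theorem uStat_sub_theta (P : Measure Ω) (X : ℕ → Ω → ℝ) (k : ℝ → ℝ → ℝ) {n : ℕ} (hn : 2 ≤ n)
    (ω : Ω) :
    uStat k X n ω - theta P X k
      = 2 / (n : ℝ) * ∑ i ∈ Finset.range n, psi P X k (X i ω)
        + uStat (degeneratePart P X k) X n ω := by
  have hn' : (2 : ℝ) ≤ n := by exact_mod_cast hn
  have hn0 : (n : ℝ) ≠ 0 := by linarith
  have hn1 : (n : ℝ) - 1 ≠ 0 := by linarith
  have hsum : ∑ j ∈ Finset.range n, ∑ i ∈ Finset.range j, degeneratePart P X k (X i ω) (X j ω)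
      = ∑ j ∈ Finset.range n, ∑ i ∈ Finset.range j, k (X i ω) (X j ω)
        - (n : ℝ) * ((n : ℝ) - 1) / 2 * theta P X k
        - ((n : ℝ) - 1) * ∑ i ∈ Finset.range n, psi P X k (X i ω) := by
    rw [← sum_range_sum_range_const, ← sum_range_sum_range_add]
    simp only [← Finset.sum_sub_distrib, degeneratePart, ← sub_sub]
  unfold uStat
  rw [hsum]
  field_simp
  ring

end Algebra

/-! ### U-statistics of an i.i.d. sample -/

section Sample

variable {Ω : Type*} [MeasurableSpace Ω] {P : Measure Ω} {X : ℕ → Ω → ℝ}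
  {k l : ℝ → ℝ → ℝ} {i j : ℕ}

theorem aemeasurable_uStat (hX : ∀ i, AEMeasurable (X i) P)
    (hk : Measurable (Function.uncurry k)) (n : ℕ) : AEMeasurable (uStat k X n) P :=
  (Finset.aemeasurable_fun_sum _ fun j _ => Finset.aemeasurable_fun_sum _ fun i _ =>
    hk.comp_aemeasurable ((hX i).prodMk (hX j))).const_mul _

variable [IsProbabilityMeasure P]

theorem identDistrib_prodMk_of_ne (hindep : iIndepFun X P)
    (hident : ∀ i, IdentDistrib (X i) (X 0) P P) (hij : i ≠ j) :
    IdentDistrib (fun ω => (X i ω, X j ω)) (fun ω => (X 0 ω, X 1 ω)) P P :=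
  (hident i).prodMk ((hident j).trans (hident 1).symm) (hindep.indepFun hij)
    (hindep.indepFun zero_ne_one)

theorem identDistrib_kernel_of_ne (hindep : iIndepFun X P)
    (hident : ∀ i, IdentDistrib (X i) (X 0) P P) (hk : Measurable (Function.uncurry k))
    (hij : i ≠ j) :
    IdentDistrib (fun ω => k (X i ω) (X j ω)) (fun ω => k (X 0 ω) (X 1 ω)) P P :=
  (identDistrib_prodMk_of_ne hindep hident hij).comp hk

theorem identDistrib_kernel_prod (hindep : iIndepFun X P)
    (hident : ∀ i, IdentDistrib (X i) (X 0) P P) (hk : Measurable (Function.uncurry k)) :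
    IdentDistrib (fun ω => k (X 0 ω) (X 1 ω)) (fun z : Ω × Ω => k (X 0 z.1) (X 1 z.2))
      P (P.prod P) :=
  (identDistrib_prodMk_prod_of_indepFun (hindep.indepFun zero_ne_one)
    (hident 0).aemeasurable_fst (hident 1).aemeasurable_fst).comp hk

theorem ae_integrable_kernel (hindep : iIndepFun X P)
    (hident : ∀ i, IdentDistrib (X i) (X 0) P P) (hk : Measurable (Function.uncurry k))
    (hint : Integrable (fun ω => k (X 0 ω) (X 1 ω)) P) :
    ∀ᵐ ω ∂P, Integrable (fun ω' => k (X 0 ω) (X 1 ω')) P :=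
  ((identDistrib_kernel_prod hindep hident hk).integrable_snd hint).prod_right_ae

/-! #### The projection -/

theorem measurable_integral_kernel {Y : Ω → ℝ} (hY : AEMeasurable Y P)
    (hk : Measurable (Function.uncurry k)) : Measurable fun x => ∫ ω, k x (Y ω) ∂P := by
  have := Measure.isProbabilityMeasure_map hY
  have hsection (x : ℝ) : ∫ ω, k x (Y ω) ∂P = ∫ y, k x y ∂(P.map Y) :=
    (integral_map hY (hk.comp measurable_prodMk_left).aestronglyMeasurable).symm
  simp_rw [hsection]
  exact (hk.stronglyMeasurable.integral_prod_right (ν := P.map Y)).measurable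

theorem measurable_psi (hX : AEMeasurable (X 1) P) (hk : Measurable (Function.uncurry k)) :
    Measurable (psi P X k) :=
  measurable_integral_kernel (k := fun x y => k x y - theta P X k) hX (hk.sub_const _)

theorem identDistrib_psi (hident : ∀ i, IdentDistrib (X i) (X 0) P P)
    (hk : Measurable (Function.uncurry k)) (i : ℕ) :
    IdentDistrib (fun ω => psi P X k (X i ω)) (fun ω => psi P X k (X 0 ω)) P P :=
  (hident i).comp (measurable_psi (hident 1).aemeasurable_fst hk)

theorem memLp_psi (hindep : iIndepFun X P) (hident : ∀ i, IdentDistrib (X i) (X 0) P P)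
    (hk : Measurable (Function.uncurry k)) (hL2 : MemLp (fun ω => k (X 0 ω) (X 1 ω)) 2 P) (i : ℕ) :
    MemLp (fun ω => psi P X k (X i ω)) 2 P :=
  (identDistrib_psi hident hk i).memLp_iff.2 <| memLp_two_integral_prod
    (((identDistrib_kernel_prod hindep hident hk).memLp_snd hL2).sub (memLp_const (theta P X k)))

theorem integral_psi (hindep : iIndepFun X P) (hident : ∀ i, IdentDistrib (X i) (X 0) P P)
    (hk : Measurable (Function.uncurry k)) (hint : Integrable (fun ω => k (X 0 ω) (X 1 ω)) P)
    (i : ℕ) : ∫ ω, psi P X k (X i ω) ∂P = 0 := by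
  have hfubini := integral_comp_of_indepFun (hindep.indepFun zero_ne_one)
    (hident 0).aemeasurable_fst (hident 1).aemeasurable_fst
    (f := fun p => k p.1 p.2 - theta P X k) (hk.sub_const _) (hint.sub (integrable_const _))
  rw [(identDistrib_psi hident hk i).integral_eq]
  refine hfubini.symm.trans ?_
  rw [integral_sub hint (integrable_const _), integral_const, probReal_univ, one_smul, theta,
    sub_self]

theorem variance_psi (hindep : iIndepFun X P) (hident : ∀ i, IdentDistrib (X i) (X 0) P P)
    (hk : Measurable (Function.uncurry k)) (hint : Integrable (fun ω => k (X 0 ω) (X 1 ω)) P) :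
    Var[fun ω => psi P X k (X 0 ω); P] = eta P X k k := by
  rw [variance_of_integral_eq_zero (identDistrib_psi hident hk 0).aemeasurable_fst
    (integral_psi hindep hident hk hint 0)]
  simp only [eta, sq]

theorem psi_sub_mul_ae_eq (hindep : iIndepFun X P) (hident : ∀ i, IdentDistrib (X i) (X 0) P P)
    (hk : Measurable (Function.uncurry k)) (hl : Measurable (Function.uncurry l))
    (hk1 : Integrable (fun ω => k (X 0 ω) (X 1 ω)) P)
    (hl1 : Integrable (fun ω => l (X 0 ω) (X 1 ω)) P) (c : ℝ) :
    (fun ω => psi P X (fun x y => k x y - c * l x y) (X 0 ω))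
      =ᵐ[P] fun ω => psi P X k (X 0 ω) - c * psi P X l (X 0 ω) := by
  have htheta : theta P X (fun x y => k x y - c * l x y) = theta P X k - c * theta P X l := by
    unfold theta
    rw [integral_sub hk1 (hl1.const_mul c), integral_const_mul]
  filter_upwards [ae_integrable_kernel hindep hident hk hk1,
    ae_integrable_kernel hindep hident hl hl1] with ω hkω hlω
  have hkω' : Integrable (fun ω' => k (X 0 ω) (X 1 ω') - theta P X k) P :=
    hkω.sub (integrable_const _)
  have hlω' : Integrable (fun ω' => c * (l (X 0 ω) (X 1 ω') - theta P X l)) P :=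
    (hlω.sub (integrable_const _)).const_mul c
  simp only [psi]
  rw [htheta, ← integral_const_mul, ← integral_sub hkω' hlω']
  refine integral_congr_ae (ae_of_all _ fun ω' => ?_)
  ring

theorem eta_sub_mul (hindep : iIndepFun X P) (hident : ∀ i, IdentDistrib (X i) (X 0) P P)
    (hk : Measurable (Function.uncurry k)) (hl : Measurable (Function.uncurry l))
    (hk2 : MemLp (fun ω => k (X 0 ω) (X 1 ω)) 2 P) (hl2 : MemLp (fun ω => l (X 0 ω) (X 1 ω)) 2 P)
    (c : ℝ) :
    eta P X (fun x y => k x y - c * l x y) (fun x y => k x y - c * l x y)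
      = eta P X k k - 2 * c * eta P X k l + c ^ 2 * eta P X l l := by
  have hψk := memLp_psi hindep hident hk hk2 0
  have hψl := memLp_psi hindep hident hl hl2 0
  have hkk : Integrable (fun ω => psi P X k (X 0 ω) * psi P X k (X 0 ω)) P :=
    hψk.integrable_mul hψk
  have hkl : Integrable (fun ω => 2 * c * (psi P X k (X 0 ω) * psi P X l (X 0 ω))) P :=
    (hψk.integrable_mul hψl).const_mul (2 * c)
  have hll : Integrable (fun ω => c ^ 2 * (psi P X l (X 0 ω) * psi P X l (X 0 ω))) P :=
    (hψl.integrable_mul hψl).const_mul (c ^ 2)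
  unfold eta
  rw [← integral_const_mul, ← integral_const_mul, ← integral_sub hkk hkl]
  refine Eq.trans ?_ (integral_add (hkk.sub hkl) hll)
  refine integral_congr_ae ?_
  filter_upwards [psi_sub_mul_ae_eq hindep hident hk hl (hk2.integrable one_le_two)
    (hl2.integrable one_le_two) c] with ω hω
  simp only [hω]
  ring

/-! #### Degenerate kernels -/

theorem ae_integral_kernel_eq_zero (hident : ∀ i, IdentDistrib (X i) (X 0) P P)
    (hk : Measurable (Function.uncurry k))
    (hdeg : ∀ᵐ ω ∂P, ∫ ω', k (X 0 ω) (X 1 ω') ∂P = 0) (i j : ℕ) :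
    ∀ᵐ ω ∂P, ∫ ω', k (X i ω) (X j ω') ∂P = 0 := by
  have hsection (x : ℝ) : ∫ ω', k x (X j ω') ∂P = ∫ ω', k x (X 1 ω') ∂P :=
    (((hident j).trans (hident 1).symm).comp (hk.comp measurable_prodMk_left)).integral_eq
  simp_rw [hsection]
  exact (hident i).symm.ae_snd (measurable_integral_kernel (hident 1).aemeasurable_fst hk
    (measurableSet_singleton 0)) hdeg

theorem integral_kernel_eq_zero (hindep : iIndepFun X P)
    (hident : ∀ i, IdentDistrib (X i) (X 0) P P) (hk : Measurable (Function.uncurry k))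
    (hint : Integrable (fun ω => k (X 0 ω) (X 1 ω)) P)
    (hdeg : ∀ᵐ ω ∂P, ∫ ω', k (X 0 ω) (X 1 ω') ∂P = 0) (hij : i ≠ j) :
    ∫ ω, k (X i ω) (X j ω) ∂P = 0 := by
  rw [(identDistrib_kernel_of_ne hindep hident hk hij).integral_eq]
  refine (integral_comp_of_indepFun (hindep.indepFun zero_ne_one) (hident 0).aemeasurable_fst
    (hident 1).aemeasurable_fst hk hint).trans ?_
  exact integral_eq_zero_of_ae hdeg

theorem covariance_kernel_shared_eq_zero (hindep : iIndepFun X P)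
    (hident : ∀ i, IdentDistrib (X i) (X 0) P P) (hk : Measurable (Function.uncurry k))
    (hL2 : MemLp (fun ω => k (X 0 ω) (X 1 ω)) 2 P)
    (hdeg : ∀ᵐ ω ∂P, ∫ ω', k (X 0 ω) (X 1 ω') ∂P = 0) {a b c : ℕ} (hab : a ≠ b) (hac : a ≠ c)
    (hbc : b ≠ c) :
    cov[fun ω => k (X a ω) (X b ω), fun ω => k (X a ω) (X c ω); P] = 0 := by
  have hX (i : ℕ) : AEMeasurable (X i) P := (hident i).aemeasurable_fst
  have hL2ab := (identDistrib_kernel_of_ne hindep hident hk hab).memLp_iff.2 hL2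
  have hL2ac := (identDistrib_kernel_of_ne hindep hident hk hac).memLp_iff.2 hL2
  have hmul : Measurable fun p : (ℝ × ℝ) × ℝ => k p.1.1 p.2 * k p.1.1 p.1.2 :=
    (hk.comp ((measurable_fst.comp measurable_fst).prodMk measurable_snd)).mul
      (hk.comp measurable_fst)
  rw [covariance_eq_sub hL2ab hL2ac, integral_kernel_eq_zero hindep hident hk
    (hL2.integrable one_le_two) hdeg hab, zero_mul, sub_zero]
  -- `X b` is independent of `(X a, X c)`, so integrating it out first leaves a zero section.
  refine (integral_comp_of_indepFun (hindep.indepFun_prodMk₀ hX a c b hab hbc.symm)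
    ((hX a).prodMk (hX c)) (hX b) hmul (hL2ab.integrable_mul hL2ac)).trans ?_
  refine integral_eq_zero_of_ae ?_
  filter_upwards [ae_integral_kernel_eq_zero hident hk hdeg a b] with ω hω
  simp only [integral_mul_const, hω, zero_mul, Pi.zero_apply]

theorem covariance_kernel_eq_zero (hindep : iIndepFun X P)
    (hident : ∀ i, IdentDistrib (X i) (X 0) P P) (hk : Measurable (Function.uncurry k))
    (hL2 : MemLp (fun ω => k (X 0 ω) (X 1 ω)) 2 P) (hsymm : ∀ x y, k x y = k y x)
    (hdeg : ∀ᵐ ω ∂P, ∫ ω', k (X 0 ω) (X 1 ω') ∂P = 0) {i j r s : ℕ} (hij : i < j) (hrs : r < s)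
    (hne : ¬(i = r ∧ j = s)) :
    cov[fun ω => k (X i ω) (X j ω), fun ω => k (X r ω) (X s ω); P] = 0 := by
  have hX (i : ℕ) : AEMeasurable (X i) P := (hident i).aemeasurable_fst
  have hswap (a b : ℕ) : (fun ω => k (X a ω) (X b ω)) = fun ω => k (X b ω) (X a ω) :=
    funext fun ω => hsymm _ _
  have hshared {a b c : ℕ} := covariance_kernel_shared_eq_zero (a := a) (b := b) (c := c)
    hindep hident hk hL2 hdeg
  by_cases hir : i = r
  · subst hir
    exact hshared hij.ne hrs.ne (by omega)
  by_cases hjs : j = s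
  · subst hjs
    rw [hswap i, hswap r]
    exact hshared hij.ne' hrs.ne' hir
  by_cases his : i = s
  · subst his
    rw [hswap r]
    exact hshared hij.ne hrs.ne' (by omega)
  by_cases hjr : j = r
  · subst hjr
    rw [hswap i]
    exact hshared hij.ne' hrs.ne (by omega)
  have hindep2 := hindep.indepFun_prodMk_prodMk₀ hX i j r s hir his hjr hjs
  exact (hindep2.comp hk hk).covariance_eq_zero
    ((identDistrib_kernel_of_ne hindep hident hk hij.ne).memLp_iff.2 hL2)
    ((identDistrib_kernel_of_ne hindep hident hk hrs.ne).memLp_iff.2 hL2)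

theorem memLp_uStat (hindep : iIndepFun X P) (hident : ∀ i, IdentDistrib (X i) (X 0) P P)
    (hk : Measurable (Function.uncurry k)) (hL2 : MemLp (fun ω => k (X 0 ω) (X 1 ω)) 2 P) (n : ℕ) :
    MemLp (uStat k X n) 2 P :=
  (memLp_finsetSum _ fun _ _ => memLp_finsetSum _ fun _ hi =>
    (identDistrib_kernel_of_ne hindep hident hk (Finset.mem_range.1 hi).ne).memLp_iff.2
      hL2).const_mul _

theorem integral_uStat_eq_zero (hindep : iIndepFun X P)
    (hident : ∀ i, IdentDistrib (X i) (X 0) P P) (hk : Measurable (Function.uncurry k))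
    (hint : Integrable (fun ω => k (X 0 ω) (X 1 ω)) P)
    (hdeg : ∀ᵐ ω ∂P, ∫ ω', k (X 0 ω) (X 1 ω') ∂P = 0) (n : ℕ) :
    ∫ ω, uStat k X n ω ∂P = 0 := by
  have hint' {i j : ℕ} (hi : i ∈ Finset.range j) : Integrable (fun ω => k (X i ω) (X j ω)) P :=
    (identDistrib_kernel_of_ne hindep hident hk (Finset.mem_range.1 hi).ne).integrable_iff.2 hint
  simp only [uStat]
  rw [integral_const_mul, integral_finsetSum _ fun j _ => integrable_finsetSum _ fun i hi =>
    hint' hi, Finset.sum_eq_zero, mul_zero]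
  intro j _
  rw [integral_finsetSum _ fun i hi => hint' hi]
  exact Finset.sum_eq_zero fun i hi =>
    integral_kernel_eq_zero hindep hident hk hint hdeg (Finset.mem_range.1 hi).ne

theorem variance_uStat_of_degenerate (hindep : iIndepFun X P)
    (hident : ∀ i, IdentDistrib (X i) (X 0) P P) (hk : Measurable (Function.uncurry k))
    (hL2 : MemLp (fun ω => k (X 0 ω) (X 1 ω)) 2 P) (hsymm : ∀ x y, k x y = k y x)
    (hdeg : ∀ᵐ ω ∂P, ∫ ω', k (X 0 ω) (X 1 ω') ∂P = 0) (n : ℕ) :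
    Var[uStat k X n; P]
      = 2 / ((n : ℝ) * ((n : ℝ) - 1)) * Var[fun ω => k (X 0 ω) (X 1 ω); P] := by
  let pairs : Finset (Σ _ : ℕ, ℕ) := (Finset.range n).sigma Finset.range
  have hlt {p : Σ _ : ℕ, ℕ} (hp : p ∈ pairs) : p.2 < p.1 :=
    Finset.mem_range.1 (Finset.mem_sigma.1 hp).2
  have hidentD {p : Σ _ : ℕ, ℕ} (hp : p ∈ pairs) :=
    identDistrib_kernel_of_ne hindep hident hk (hlt hp).ne
  have hsum : Var[fun ω => ∑ p ∈ pairs, k (X p.2 ω) (X p.1 ω); P]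
      = (n : ℝ) * ((n : ℝ) - 1) / 2 * Var[fun ω => k (X 0 ω) (X 1 ω); P] := by
    rw [variance_fun_sum_of_covariance_eq_zero
      (Y := fun (p : Σ _ : ℕ, ℕ) ω => k (X p.2 ω) (X p.1 ω))
      (fun p hp => (hidentD hp).memLp_iff.2 hL2) fun p hp q hq hpq =>
        covariance_kernel_eq_zero hindep hident hk hL2 hsymm hdeg (hlt hp) (hlt hq) fun h =>
          hpq (Sigma.ext h.2 (heq_of_eq h.1)),
      Finset.sum_congr rfl fun p hp => (hidentD hp).variance_eq, ← sum_range_sum_range_const,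
      Finset.sum_sigma']
  unfold uStat
  simp_rw [Finset.sum_sigma']
  rw [variance_const_mul, hsum]
  rcases eq_or_ne ((n : ℝ) * ((n : ℝ) - 1)) 0 with h0 | _
  · simp [h0]
  · field_simp

theorem tendstoInMeasure_sqrt_mul_uStat_of_degenerate (hindep : iIndepFun X P)
    (hident : ∀ i, IdentDistrib (X i) (X 0) P P) (hk : Measurable (Function.uncurry k))
    (hL2 : MemLp (fun ω => k (X 0 ω) (X 1 ω)) 2 P) (hsymm : ∀ x y, k x y = k y x)
    (hdeg : ∀ᵐ ω ∂P, ∫ ω', k (X 0 ω) (X 1 ω') ∂P = 0) :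
    TendstoInMeasure P (fun (n : ℕ) ω => √(n : ℝ) * uStat k X n ω) atTop 0 := by
  have hmean (n : ℕ) : ∫ ω, √(n : ℝ) * uStat k X n ω ∂P = 0 := by
    rw [integral_const_mul, integral_uStat_eq_zero hindep hident hk (hL2.integrable one_le_two)
      hdeg, mul_zero]
  have hvar : Tendsto (fun n : ℕ => Var[fun ω => √(n : ℝ) * uStat k X n ω; P]) atTop (𝓝 0) := by
    have hlim : Tendsto (fun n : ℕ => 2 * Var[fun ω => k (X 0 ω) (X 1 ω); P] / ((n : ℝ) - 1))
        atTop (𝓝 0) :=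
      (tendsto_atTop_add_const_right _ (-1) tendsto_natCast_atTop_atTop).const_div_atTop _
    refine hlim.congr' ?_
    filter_upwards [eventually_ne_atTop 0] with n hn
    rw [variance_const_mul, variance_uStat_of_degenerate hindep hident hk hL2 hsymm hdeg,
      Real.sq_sqrt n.cast_nonneg]
    have hn' : (n : ℝ) ≠ 0 := by exact_mod_cast hn
    field_simp
  simpa only [hmean, sub_zero] using tendstoInMeasure_sub_integral_of_tendsto_variance
    (fun n => (memLp_uStat hindep hident hk hL2 n).const_mul _) hvar

/-! #### Asymptotic normality -/

theorem measurable_degeneratePart (hX : AEMeasurable (X 1) P)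
    (hk : Measurable (Function.uncurry k)) :
    Measurable (Function.uncurry (degeneratePart P X k)) :=
  have hψ := measurable_psi hX hk
  ((hk.sub_const _).sub (hψ.comp measurable_fst)).sub (hψ.comp measurable_snd)

theorem memLp_degeneratePart (hindep : iIndepFun X P)
    (hident : ∀ i, IdentDistrib (X i) (X 0) P P) (hk : Measurable (Function.uncurry k))
    (hL2 : MemLp (fun ω => k (X 0 ω) (X 1 ω)) 2 P) :
    MemLp (fun ω => degeneratePart P X k (X 0 ω) (X 1 ω)) 2 P :=
  ((hL2.sub (memLp_const _)).sub (memLp_psi hindep hident hk hL2 0)).sub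
    (memLp_psi hindep hident hk hL2 1)

theorem ae_integral_degeneratePart_eq_zero (hindep : iIndepFun X P)
    (hident : ∀ i, IdentDistrib (X i) (X 0) P P) (hk : Measurable (Function.uncurry k))
    (hL2 : MemLp (fun ω => k (X 0 ω) (X 1 ω)) 2 P) :
    ∀ᵐ ω ∂P, ∫ ω', degeneratePart P X k (X 0 ω) (X 1 ω') ∂P = 0 := by
  have hint := hL2.integrable one_le_two
  filter_upwards [ae_integrable_kernel hindep hident hk hint] with ω hω
  have hcentred : Integrable (fun ω' => k (X 0 ω) (X 1 ω') - theta P X k) P :=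
    hω.sub (integrable_const _)
  have hprojected : Integrable
      (fun ω' => k (X 0 ω) (X 1 ω') - theta P X k - psi P X k (X 0 ω)) P :=
    hcentred.sub (integrable_const _)
  unfold degeneratePart
  rw [integral_sub hprojected ((memLp_psi hindep hident hk hL2 1).integrable one_le_two),
    integral_sub hcentred (integrable_const _), integral_psi hindep hident hk hint 1]
  simp [psi]

theorem tendstoInDistribution_sqrt_mul_uStat_sub {Ω' : Type*} [MeasurableSpace Ω']
    {P' : Measure Ω'} [IsProbabilityMeasure P'] {Z : Ω' → ℝ} (hindep : iIndepFun X P)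
    (hident : ∀ i, IdentDistrib (X i) (X 0) P P) (hk : Measurable (Function.uncurry k))
    (hL2 : MemLp (fun ω => k (X 0 ω) (X 1 ω)) 2 P) (hsymm : ∀ x y, k x y = k y x)
    (hZ : HasLaw Z (gaussianReal 0 (4 * eta P X k k).toNNReal) P') :
    TendstoInDistribution (fun (n : ℕ) ω => √(n : ℝ) * (uStat k X n ω - theta P X k)) atTop Z
      (fun _ => P) P' := by
  have hX (i : ℕ) : AEMeasurable (X i) P := (hident i).aemeasurable_fst
  have hint := hL2.integrable one_le_two
  have hhalf : HasLaw (fun ω => 2⁻¹ * Z ω)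
      (gaussianReal 0 Var[fun ω => psi P X k (X 0 ω); P].toNNReal) P' := by
    convert hasLaw_gaussianReal_toNNReal_const_mul hZ 2⁻¹ using 3
    rw [variance_psi hindep hident hk hint]
    ring
  have hproj := (tendstoInDistribution_inv_sqrt_mul_sum_sub
    (X := fun i ω => psi P X k (X i ω)) hhalf (memLp_psi hindep hident hk hL2 0)
    (hindep.comp (fun _ => psi P X k) fun _ => measurable_psi (hX 1) hk)
    (identDistrib_psi hident hk)).continuous_comp (g := fun x : ℝ => 2 * x) (by fun_prop)
  simp only [Function.comp_def, mul_inv_cancel_left₀ (two_ne_zero' ℝ),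
    integral_psi hindep hident hk hint 0, mul_zero, sub_zero] at hproj
  refine tendstoInDistribution_of_tendstoInMeasure_sub _ _ hproj ?_ fun n =>
    ((aemeasurable_uStat hX hk n).sub_const _).const_mul _
  refine (tendstoInMeasure_sqrt_mul_uStat_of_degenerate hindep hident
    (measurable_degeneratePart (hX 1) hk) (memLp_degeneratePart hindep hident hk hL2)
    (degeneratePart_symm hsymm)
    (ae_integral_degeneratePart_eq_zero hindep hident hk hL2)).congr' ?_ .rfl
  filter_upwards [eventually_ge_atTop 2] with n hn
  refine ae_of_all _ fun ω => ?_
  have hsqrt : √(n : ℝ) * (2 / (n : ℝ)) = 2 * (√(n : ℝ))⁻¹ := by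
    rw [mul_div_left_comm, Real.sqrt_div_self]
  simp only [Pi.sub_apply, uStat_sub_theta P X k hn, mul_add, ← mul_assoc, hsqrt]
  ring

theorem tendstoInMeasure_uStat (hindep : iIndepFun X P)
    (hident : ∀ i, IdentDistrib (X i) (X 0) P P) (hk : Measurable (Function.uncurry k))
    (hL2 : MemLp (fun ω => k (X 0 ω) (X 1 ω)) 2 P) (hsymm : ∀ x y, k x y = k y x) :
    TendstoInMeasure P (uStat k X) atTop fun _ => theta P X k :=
  tendstoInMeasure_const_of_tendstoInDistribution_mul_sub
    (Real.tendsto_sqrt_atTop.comp tendsto_natCast_atTop_atTop)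
    (tendstoInDistribution_sqrt_mul_uStat_sub hindep hident hk hL2 hsymm HasLaw.id)

theorem tendstoInDistribution_sqrt_mul_uStat_div_uStat_sub {Ω' : Type*} [MeasurableSpace Ω']
    {P' : Measure Ω'} [IsProbabilityMeasure P'] {Z : Ω' → ℝ} {r : ℝ} (hindep : iIndepFun X P)
    (hident : ∀ i, IdentDistrib (X i) (X 0) P P) (hk : Measurable (Function.uncurry k))
    (hl : Measurable (Function.uncurry l)) (hk2 : MemLp (fun ω => k (X 0 ω) (X 1 ω)) 2 P)
    (hl2 : MemLp (fun ω => l (X 0 ω) (X 1 ω)) 2 P) (hksymm : ∀ x y, k x y = k y x)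
    (hlsymm : ∀ x y, l x y = l y x) (hθ : theta P X l ≠ 0) (hr : r * theta P X l = theta P X k)
    (hZ : HasLaw Z (gaussianReal 0 (4 / theta P X l ^ 2 *
      (eta P X k k - 2 * r * eta P X k l + r ^ 2 * eta P X l l)).toNNReal) P') :
    TendstoInDistribution (fun (n : ℕ) ω => √(n : ℝ) * (uStat k X n ω / uStat l X n ω - r)) atTop Z
      (fun _ => P) P' := by
  have hX (i : ℕ) : AEMeasurable (X i) P := (hident i).aemeasurable_fst
  set κ : ℝ → ℝ → ℝ := fun x y => k x y - r * l x y
  have hκ : Measurable (Function.uncurry κ) := hk.sub (hl.const_mul r)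
  have hκθ : theta P X κ = 0 := by
    simp only [theta, κ] at hr ⊢
    rw [integral_sub (hk2.integrable one_le_two) ((hl2.integrable one_le_two).const_mul r),
      integral_const_mul, hr, sub_self]
  have hθZ : HasLaw (fun ω => theta P X l * Z ω)
      (gaussianReal 0 (4 * eta P X κ κ).toNNReal) P' := by
    convert hasLaw_gaussianReal_toNNReal_const_mul hZ (theta P X l) using 3
    rw [eta_sub_mul hindep hident hk hl hk2 hl2]
    field_simp
  have hnum := tendstoInDistribution_sqrt_mul_uStat_sub hindep hident hκ
    (hk2.sub (hl2.const_mul r)) (fun x y => by simp only [κ, hksymm x y, hlsymm x y]) hθZ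
  have hden := tendstoInMeasure_uStat hindep hident hl hl2 hlsymm
  have hquot := tendstoInDistribution_div hθ hnum hden (aemeasurable_uStat hX hl)
  simp only [mul_div_cancel_left₀ _ hθ] at hquot
  refine tendstoInDistribution_of_tendstoInMeasure_sub _ _ hquot ?_ fun n =>
    (((aemeasurable_uStat hX hk n).div (aemeasurable_uStat hX hl n)).sub_const _).const_mul _
  -- The two sequences agree wherever `uStat l X n` is nonzero, so division by zero is harmless.
  refine tendstoInMeasure_zero_of_tendsto_measure_support <|
    tendsto_of_tendsto_of_tendsto_of_le_of_le tendsto_const_nhds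
      (tendsto_measure_eq_zero_of_tendstoInMeasure_const hθ hden) (fun _ => zero_le)
      fun n => measure_mono fun ω => ?_
  contrapose
  intro hne
  simp only [Set.mem_ofPred_eq] at hne
  simp only [Function.mem_support, not_not, Pi.sub_apply, hκθ, sub_zero, κ, uStat_sub_mul]
  field_simp
  ring

end Sample

/-! ### The tail kernels -/

section Kernels

theorem measurable_h1 (d : ℝ) : Measurable (Function.uncurry (h1 d)) :=
  Measurable.ite (measurableSet_lt measurable_const (measurable_fst.add measurable_snd))
    ((measurable_fst.sub measurable_snd).abs.div (measurable_fst.add measurable_snd))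
    measurable_const

theorem measurable_h2 (d : ℝ) : Measurable (Function.uncurry (h2 d)) :=
  Measurable.ite (measurableSet_lt measurable_const (measurable_fst.add measurable_snd))
    measurable_const measurable_const

theorem h1_symm (d x y : ℝ) : h1 d x y = h1 d y x := by
  unfold h1
  rw [add_comm x y, abs_sub_comm x y]

theorem h2_symm (d x y : ℝ) : h2 d x y = h2 d y x := by
  unfold h2
  rw [add_comm x y]

theorem abs_h1_le_one (d : ℝ) {x y : ℝ} (hx : 0 ≤ x) (hy : 0 ≤ y) : |h1 d x y| ≤ 1 := by
  have hsum : 0 ≤ x + y := add_nonneg hx hy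
  unfold h1
  split_ifs
  · rw [abs_div, abs_abs, abs_of_nonneg hsum]
    exact div_le_one_of_le₀ (abs_sub_le_iff.2 ⟨by linarith, by linarith⟩) hsum
  · simp

theorem abs_h2_le_one (d x y : ℝ) : |h2 d x y| ≤ 1 := by
  unfold h2
  split_ifs <;> simp

variable {Ω : Type*} [MeasurableSpace Ω] {P : Measure Ω} {X : ℕ → Ω → ℝ}

theorem nullMeasurableSet_lt_add (hX0 : AEMeasurable (X 0) P) (hX1 : AEMeasurable (X 1) P)
    (d : ℝ) : NullMeasurableSet {ω | d < X 0 ω + X 1 ω} P :=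
  nullMeasurableSet_lt aemeasurable_const (hX0.add hX1)

theorem theta_h2 (hX0 : AEMeasurable (X 0) P) (hX1 : AEMeasurable (X 1) P) (d : ℝ) :
    theta P X (h2 d) = nu P X d := by
  have hindicator : (fun ω => h2 d (X 0 ω) (X 1 ω))
      = {ω | d < X 0 ω + X 1 ω}.indicator fun _ => (1 : ℝ) := by
    ext ω
    simp [h2, Set.indicator_apply]
  rw [theta, hindicator, integral_indicator₀ (nullMeasurableSet_lt_add hX0 hX1 d)]
  simp [nu]

theorem g_mul_nu (hX0 : AEMeasurable (X 0) P) (hX1 : AEMeasurable (X 1) P) {d : ℝ}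
    (hnu : nu P X d ≠ 0) : g P X d * nu P X d = theta P X (h1 d) := by
  have hindicator : (fun ω => h1 d (X 0 ω) (X 1 ω)) = {ω | d < X 0 ω + X 1 ω}.indicator
      fun ω => |X 0 ω - X 1 ω| / (X 0 ω + X 1 ω) := by
    ext ω
    simp [h1, Set.indicator_apply]
  rw [theta, hindicator, integral_indicator₀ (nullMeasurableSet_lt_add hX0 hX1 d), g,
    ProbabilityTheory.cond, integral_smul_measure, ENNReal.toReal_inv, smul_eq_mul]
  change (nu P X d)⁻¹ * _ * nu P X d = _
  field_simp

variable [IsProbabilityMeasure P]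

theorem memLp_h1 {p : ENNReal} (hX0 : AEMeasurable (X 0) P) (hX1 : AEMeasurable (X 1) P)
    (hpos0 : ∀ᵐ ω ∂P, 0 ≤ X 0 ω) (hpos1 : ∀ᵐ ω ∂P, 0 ≤ X 1 ω) (d : ℝ) :
    MemLp (fun ω => h1 d (X 0 ω) (X 1 ω)) p P :=
  MemLp.of_bound ((measurable_h1 d).comp_aemeasurable (hX0.prodMk hX1)).aestronglyMeasurable 1 <| by
    filter_upwards [hpos0, hpos1] with ω hω0 hω1 using abs_h1_le_one d hω0 hω1

theorem memLp_h2 {p : ENNReal} (hX0 : AEMeasurable (X 0) P) (hX1 : AEMeasurable (X 1) P) (d : ℝ) :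
    MemLp (fun ω => h2 d (X 0 ω) (X 1 ω)) p P :=
  MemLp.of_bound ((measurable_h2 d).comp_aemeasurable (hX0.prodMk hX1)).aestronglyMeasurable 1 <|
    ae_of_all _ fun _ => abs_h2_le_one d _ _

end Kernels

end GammaTail

open GammaTail in
theorem theorem4_general {Ω : Type*} [MeasurableSpace Ω] (P : Measure Ω) [IsProbabilityMeasure P]
    (X : ℕ → Ω → ℝ) (hindep : iIndepFun X P) (hident : ∀ i, IdentDistrib (X i) (X 0) P P)
    (hpos : ∀ᵐ ω ∂P, 0 < X 0 ω) (d : ℝ) (hnu : 0 < nu P X d) :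
    0 ≤ sigmaSq P X d ∧
      TendstoInDistribution
        (fun (n : ℕ) (ω : Ω) => √((n : ℝ) * nu P X d) * (gHat X d n ω - g P X d))
        atTop (id : ℝ → ℝ) (fun _ => P) (gaussianReal 0 (sigmaSq P X d).toNNReal) := by
  have hX (i : ℕ) : AEMeasurable (X i) P := (hident i).aemeasurable_fst
  have hpos1 : ∀ᵐ ω ∂P, 0 < X 1 ω := (hident 1).symm.ae_snd measurableSet_Ioi hpos
  have hL1 := memLp_h1 (p := 2) (hX 0) (hX 1) (hpos.mono fun _ h => h.le)
    (hpos1.mono fun _ h => h.le) d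
  have hL2 := memLp_h2 (p := 2) (hX 0) (hX 1) d
  have hθ := theta_h2 (hX 0) (hX 1) d
  constructor
  · rw [sigmaSq, ← eta_sub_mul hindep hident (measurable_h1 d) (measurable_h2 d) hL1 hL2]
    exact mul_nonneg (by positivity) (integral_nonneg fun ω => mul_self_nonneg _)
  have hscale : HasLaw (fun x => (√(nu P X d))⁻¹ * id x)
      (gaussianReal 0 (4 / theta P X (h2 d) ^ 2 * (eta P X (h1 d) (h1 d)
        - 2 * g P X d * eta P X (h1 d) (h2 d)
        + g P X d ^ 2 * eta P X (h2 d) (h2 d))).toNNReal)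
      (gaussianReal 0 (sigmaSq P X d).toNNReal) := by
    convert hasLaw_gaussianReal_toNNReal_const_mul HasLaw.id (√(nu P X d))⁻¹ using 3
    rw [inv_pow, Real.sq_sqrt hnu.le, hθ, sigmaSq]
    field_simp
  have hratio := (tendstoInDistribution_sqrt_mul_uStat_div_uStat_sub hindep hident
    (measurable_h1 d) (measurable_h2 d) hL1 hL2 (h1_symm d) (h2_symm d) (hθ ▸ hnu.ne')
    (hθ ▸ g_mul_nu (hX 0) (hX 1) hnu.ne') hscale).continuous_comp
    (g := fun x => √(nu P X d) * x) (by fun_prop)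
  simp_rw [mul_comm _ (nu P X d), Real.sqrt_mul hnu.le, mul_assoc]
  simp only [Function.comp_def, mul_inv_cancel_left₀ (Real.sqrt_pos.2 hnu).ne'] at hratio
  exact hratio
theorem theorem4 {Ω : Type*} [MeasurableSpace Ω] (P : Measure Ω) [IsProbabilityMeasure P]
    (X : ℕ → Ω → ℝ)
    (hindep : iIndepFun X P)
    (hident : ∀ i, IdentDistrib (X i) (X 0) P P)
    (hpos : ∀ i, ∀ᵐ ω ∂P, 0 < X i ω)
    (hdens : HasPDF (X 0) P)
    (d : ℝ) (hd : 0 < d)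
    (hnu : 0 < GammaTail.nu P X d)
    (heta1 : 0 < GammaTail.eta P X (GammaTail.h1 d) (GammaTail.h1 d))
    (heta2 : 0 < GammaTail.eta P X (GammaTail.h2 d) (GammaTail.h2 d)) :
    0 ≤ GammaTail.sigmaSq P X d ∧
      TendstoInDistribution
        (fun (n : ℕ) (ω : Ω) =>
          √((n : ℝ) * GammaTail.nu P X d) * (GammaTail.gHat X d n ω - GammaTail.g P X d))
        atTop (id : ℝ → ℝ) (fun _ => P)
        (gaussianReal 0 (GammaTail.sigmaSq P X d).toNNReal) :=
  theorem4_general P X hindep hident (hpos 0) d hnu
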